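/- Let $\mathcal H_A,\mathcal H_B$ be finite-dimensional complex Hilbert spaces with fixed orthonormal bases, let $T_B$ denote the partial transpose on the second factor, $T_B(Y)=\sum_{i,j}(I_A\otimes|i\rangle\langle j|_B)\,Y\,(I_A\otimes|i\rangle\langle j|_B)$, and let $$\operatorname{PPT}(A{:}B)=\{\sigma_{AB}:\ \sigma_{AB}\ge 0,\ T_B(\sigma_{AB})\ge 0,\ \operatorname{Tr}\sigma_{AB}=1\}.$$ For a Hermitian operator $X\neq 0$, a positive semi-definite operator $\sigma\neq 0$ and a real number $\alpha\ge 1$ put $$\nu_\alpha(X\Vert\sigma)=\log_2\Big\Vert\sigma^{\frac{1-\alpha}{2\alpha}}X\sigma^{\frac{1-\alpha}{2\alpha}}\Big\Vert_\alpha,\qquad D_{\max}(X\Vert\sigma)=\log_2\big\Vert\sigma^{-1/2}X\sigma^{-1/2}\big\Vert_\infty$$ if $\operatorname{supp}(X)\subseteq\operatorname{supp}(\sigma)$, and $\nu_\alpha(X\Vert\sigma)=D_{\max}(X\Vert\sigma)=+\infty$ otherwise. Here $\Vert Y\Vert_\alpha=(\operatorname{Tr}[(Y^\dagger Y)^{\alpha/2}])^{1/\alpha}$,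 $\Vert Y\Vert_\infty$ is the operator norm, $\operatorname{supp}$ is the orthogonal complement of the kernel, and negative powers of $\sigma$ are taken on the support of $\sigma$. For a state $\rho_{AB}$ (that is, $\rho_{AB}\ge0$ and $\operatorname{Tr}\rho_{AB}=1$) define the $\alpha$-logarithmic negativity, the max-logarithmic negativity and the $\kappa$-entanglement by $$E_N^\alpha(\rho_{AB})=\inf_{\sigma_{AB}\in\operatorname{PPT}(A:B)}\nu_\alpha(T_B(\rho_{AB})\Vert\sigma_{AB}),\qquad E_N^{\max}(\rho_{AB})=\inf_{\sigma_{AB}\in\operatorname{PPT}(A:B)}D_{\max}(T_B(\rho_{AB})\Vert\sigma_{AB}),$$ $$E_\kappa(\rho_{AB})=\log_2\inf\{\operatorname{Tr}[S_{AB}]:\ -T_B(S_{AB})\le T_B(\rho_{AB})\le T_B(S_{AB}),\ S_{AB}\ge 0\}.$$ Then for every state $\rho_{AB}$, $$E_\kappa(\rho_{AB})=E_N^{\max}(\rho_{AB})=\lim_{\alpha\to\infty}E_N^\alpha(\rho_{AB}).$$ -/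

import Mathlib

open Filter Topology
open scoped ENNReal ComplexOrder MatrixOrder

/-! Operators on a finite-dimensional Hilbert space are complex matrices in a fixed orthonormal
basis. A bipartite system with local bases indexed by `a` and `b` has the product basis, indexed by
`a × b`. -/

noncomputable section

namespace LogNeg

/-- The base-two logarithm on `[0, ∞]`, with `log₂ 0 = -∞` and `log₂ ∞ = ∞`. -/
def log2 (x : ℝ≥0∞) : EReal := ENNReal.log x / ((Real.log 2 : ℝ) : EReal)

section Operators

variable {n : Type*} [Fintype n] [DecidableEq n]

/-- A quantum state (density operator): positive semidefinite with unit trace. -/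
def IsState (ρ : Matrix n n ℂ) : Prop := ρ.PosSemidef ∧ ρ.trace = 1

/-- The support of an operator: the orthogonal complement of its kernel. -/
def supp (X : Matrix n n ℂ) : Submodule ℂ (EuclideanSpace ℂ n) :=
  (LinearMap.ker (Matrix.toEuclideanLin X))ᗮ

/-- The real power `σ ^ r` of a positive semidefinite operator, taken on the support of `σ`:
every eigenvalue `x` is replaced by `x ^ r`, where `0 ^ r = 0` for `r ≠ 0`
(and `σ ^ 0` is the identity). -/
def power (σ : Matrix n n ℂ) (r : ℝ) : Matrix n n ℂ := cfc (fun x : ℝ => x ^ r) σ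

/-- The absolute value `|Y| = √(Y† Y)`. -/
def absOp (Y : Matrix n n ℂ) : Matrix n n ℂ := cfc Real.sqrt (Y.conjTranspose * Y)

/-- The norm `‖Y‖_α = (Tr |Y|^α)^(1/α)`. -/
def schattenNorm (α : ℝ) (Y : Matrix n n ℂ) : ℝ := (power (absOp Y) α).trace.re ^ (1 / α)

/-- The norm `‖Y‖_∞`, the operator norm on the Euclidean space. -/
def opNorm (Y : Matrix n n ℂ) : ℝ := ‖Matrix.toEuclideanCLM (n := n) (𝕜 := ℂ) Y‖

open Classical in
/-- `μ_α(X‖σ) = ‖σ^((1-α)/(2α)) X σ^((1-α)/(2α))‖_α` if `supp X ⊆ supp σ`, and `+∞` otherwise. -/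
def mu (α : ℝ) (X σ : Matrix n n ℂ) : ℝ≥0∞ :=
  if supp X ≤ supp σ then
    ENNReal.ofReal
      (schattenNorm α (power σ ((1 - α) / (2 * α)) * X * power σ ((1 - α) / (2 * α))))
  else ⊤

/-- `ν_α(X‖σ) = log₂ μ_α(X‖σ)`. -/
def nu (α : ℝ) (X σ : Matrix n n ℂ) : EReal := log2 (mu α X σ)

open Classical in
/-- The max-relative entropy of a Hermitian operator `X` and a positive semidefinite `σ`:
`log₂ ‖σ^(-1/2) X σ^(-1/2)‖_∞` if `supp X ⊆ supp σ`, and `+∞` otherwise. -/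
def Dmax (X σ : Matrix n n ℂ) : EReal :=
  log2 (if supp X ≤ supp σ then
    ENNReal.ofReal (opNorm (power σ (-1 / 2) * X * power σ (-1 / 2)))
  else ⊤)

end Operators

section Bipartite

variable {a b : Type*} [Fintype a] [DecidableEq a] [Fintype b] [DecidableEq b]

/-- The partial transpose `T_B`: the indices of the second system are exchanged. -/
def partialTranspose (Y : Matrix (a × b) (a × b) ℂ) : Matrix (a × b) (a × b) ℂ :=
  Matrix.of fun p q => Y (p.1, q.2) (q.1, p.2)

/-- The set of states with positive partial transpose. -/
def PPT (a b : Type*) [Fintype a] [DecidableEq a] [Fintype b] [DecidableEq b] :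
    Set (Matrix (a × b) (a × b) ℂ) :=
  {σ | σ.PosSemidef ∧ (partialTranspose σ).PosSemidef ∧ σ.trace = 1}

/-- The operators `S ≥ 0` with `-T_B(S) ≤ T_B(ρ) ≤ T_B(S)`. -/
def kappaFeasible (ρ : Matrix (a × b) (a × b) ℂ) : Set (Matrix (a × b) (a × b) ℂ) :=
  {S | -partialTranspose S ≤ partialTranspose ρ ∧ partialTranspose ρ ≤ partialTranspose S ∧ 0 ≤ S}

/-- The κ-entanglement. -/
def Ekappa (ρ : Matrix (a × b) (a × b) ℂ) : EReal :=
  log2 (⨅ S ∈ kappaFeasible ρ, ENNReal.ofReal S.trace.re)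

/-- The `α`-logarithmic negativity. -/
def logNegativity (α : ℝ) (ρ : Matrix (a × b) (a × b) ℂ) : EReal :=
  ⨅ σ ∈ PPT a b, nu α (partialTranspose ρ) σ

/-- The max-logarithmic negativity. -/
def maxLogNegativity (ρ : Matrix (a × b) (a × b) ℂ) : EReal :=
  ⨅ σ ∈ PPT a b, Dmax (partialTranspose ρ) σ

end Bipartite

end LogNeg

end

/-! Write X for `partialTranspose ρ` and d for the dimension. Adding the two constraints on a
feasible S gives T_B(S) ≥ 0, so S = t T_B(σ) with t = Tr S and σ a PPT state, and the constraints
become -tσ ≤ X ≤ tσ. Conjugation by σ^(-1/2) turns these into ‖σ^(-1/2) X σ^(-1/2)‖_∞ ≤ t, which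
gives the first equality (`kappa_le_muMax`, `exists_mem_PPT`).

For finite α > 1 the same σ works: σ ≤ 1 keeps the conjugated operator norm at most t, and passing
to the α-norm costs a factor d^(1/α). Conversely, a bound t on the α-norm gives ±X ≤ t σ^(1-1/α) ≤ t
(σ + 1/α), and t T_B(σ + 1/α) is feasible with trace t (1 + d/α) (`kappa_le_mu`). Both factors tend
to 1 and do not depend on σ, so the infima are squeezed without any compactness or exchange of
limits. -/

namespace LogNeg

/-! ### The logarithm as an order isomorphism -/

section Log

lemma strictMono_log2 : StrictMono log2 := by
  have h2 : (0 : EReal) < ((Real.log 2 : ℝ) : EReal) := by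
    exact_mod_cast Real.log_pos one_lt_two
  exact (EReal.strictMono_div_right_of_pos h2 (EReal.coe_ne_top _)).comp ENNReal.log_strictMono

/-- A strictly monotone surjection is an order isomorphism, hence continuous and compatible with
infima; the estimates can thus be made in `ℝ≥0∞`. -/
lemma surjective_log2 : Function.Surjective log2 := by
  intro y
  have h0 : ((Real.log 2 : ℝ) : EReal) ≠ 0 := by
    exact_mod_cast (Real.log_pos one_lt_two).ne'
  obtain ⟨x, hx⟩ := ENNReal.log_surjective (y * ((Real.log 2 : ℝ) : EReal))
  exact ⟨x, (EReal.div_eq_iff (EReal.coe_ne_bot _) (EReal.coe_ne_top _) h0).2 hx⟩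

/-- The base-two logarithm as an order isomorphism. -/
noncomputable def log2OrderIso : ℝ≥0∞ ≃o EReal :=
  strictMono_log2.orderIsoOfSurjective log2 surjective_log2

lemma log2_biInf {ι : Type*} (s : Set ι) (f : ι → ℝ≥0∞) :
    log2 (⨅ i ∈ s, f i) = ⨅ i ∈ s, log2 (f i) :=
  log2OrderIso.map_iInf₂ fun i (_ : i ∈ s) => f i

lemma continuous_log2 : Continuous log2 := log2OrderIso.continuous

end Log

/-! ### Functional calculus, operator norm and Schatten norms -/

section Operators

open scoped Matrix.Norms.L2Operator

variable {n : Type*} [Fintype n] [DecidableEq n]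

lemma continuousOn_spectrum (f : ℝ → ℝ) (Y : Matrix n n ℂ) : ContinuousOn f (spectrum ℝ Y) := by
  have := Y.finite_real_spectrum
  exact this.continuousOn f

lemma cfc_mul_cfc (f g : ℝ → ℝ) (Y : Matrix n n ℂ) :
    cfc f Y * cfc g Y = cfc (fun x => f x * g x) Y :=
  (cfc_mul f g Y (continuousOn_spectrum _ _) (continuousOn_spectrum _ _)).symm

lemma isSelfAdjoint_power (σ : Matrix n n ℂ) (r : ℝ) : IsSelfAdjoint (power σ r) :=
  cfc_predicate _ _

lemma norm_le_of_neg_le_of_le {Y : Matrix n n ℂ} (hY : IsSelfAdjoint Y) {t : ℝ} (ht : 0 ≤ t)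
    (h₁ : -algebraMap ℝ _ t ≤ Y) (h₂ : Y ≤ algebraMap ℝ _ t) : ‖Y‖ ≤ t := by
  rw [← cfc_id ℝ Y hY]
  refine norm_cfc_le ht fun x hx => ?_
  rw [Real.norm_eq_abs, abs_le]
  refine ⟨?_, ?_⟩
  · rw [← map_neg] at h₁
    exact (algebraMap_le_iff_le_spectrum hY).1 h₁ x hx
  · exact (le_algebraMap_iff_spectrum_le hY).1 h₂ x hx

lemma le_of_norm_le {Y : Matrix n n ℂ} (hY : IsSelfAdjoint Y) {t : ℝ} (h : ‖Y‖ ≤ t) :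
    -algebraMap ℝ _ t ≤ Y ∧ Y ≤ algebraMap ℝ _ t := by
  have h' : algebraMap ℝ (Matrix n n ℂ) ‖Y‖ ≤ algebraMap ℝ _ t := algebraMap_mono _ h
  exact ⟨(neg_le_neg h').trans hY.neg_algebraMap_norm_le_self,
    hY.le_algebraMap_norm_self.trans h'⟩

lemma spectrum_nonneg {σ : Matrix n n ℂ} (hσ : σ.PosSemidef) {x : ℝ} (hx : x ∈ spectrum ℝ σ) :
    0 ≤ x :=
  spectrum_nonneg_of_nonneg hσ.nonneg hx

/-- A positive semidefinite operator is bounded by its trace. -/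
lemma le_trace {A : Matrix n n ℂ} (hA : A.PosSemidef) :
    A ≤ algebraMap ℝ _ A.trace.re := by
  refine (le_algebraMap_iff_spectrum_le hA.1.isSelfAdjoint).2 fun x hx => ?_
  rw [hA.1.spectrum_real_eq_range_eigenvalues] at hx
  obtain ⟨i, rfl⟩ := hx
  rw [hA.1.trace_eq_sum_eigenvalues]
  simp only [Complex.coe_algebraMap, Complex.re_sum, Complex.ofReal_re]
  exact Finset.single_le_sum (fun j _ => hA.eigenvalues_nonneg j) (Finset.mem_univ i)

lemma trace_re_mono {m : Type*} [Fintype m] {A B : Matrix m m ℂ} (h : A ≤ B) : A.trace.re ≤ B.trace.re := by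
  have := (Matrix.le_iff.1 h).trace_nonneg
  rw [Matrix.trace_sub, sub_nonneg] at this
  exact (Complex.le_def.1 this).1

lemma trace_algebraMap (t : ℝ) :
    (algebraMap ℝ (Matrix n n ℂ) t).trace = (Fintype.card n * t : ℝ) := by
  rw [Algebra.algebraMap_eq_smul_one, Matrix.trace_smul, Matrix.trace_one]
  simp [mul_comm]

lemma absOp_posSemidef (Y : Matrix n n ℂ) : (absOp Y).PosSemidef :=
  Matrix.nonneg_iff_posSemidef.1 (cfc_nonneg fun x _ => Real.sqrt_nonneg x)

lemma absOp_mul_self (Y : Matrix n n ℂ) : absOp Y * absOp Y = Y.conjTranspose * Y := by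
  have h : (Y.conjTranspose * Y).PosSemidef := Matrix.posSemidef_conjTranspose_mul_self Y
  rw [absOp, cfc_mul_cfc]
  conv_rhs => rw [← cfc_id ℝ (Y.conjTranspose * Y) h.1]
  exact cfc_congr fun x hx => Real.mul_self_sqrt (spectrum_nonneg h hx)

lemma norm_absOp (Y : Matrix n n ℂ) : ‖absOp Y‖ = ‖Y‖ := by
  have h₁ : ‖absOp Y‖ * ‖absOp Y‖ = ‖Y‖ * ‖Y‖ := by
    rw [← CStarRing.norm_star_mul_self, ← CStarRing.norm_star_mul_self (x := Y),
      (absOp_posSemidef Y).1.isSelfAdjoint.star_eq, absOp_mul_self]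
    rfl
  exact (mul_self_inj (norm_nonneg _) (norm_nonneg _)).1 h₁

lemma power_posSemidef {σ : Matrix n n ℂ} (hσ : σ.PosSemidef) (r : ℝ) :
    (power σ r).PosSemidef :=
  Matrix.nonneg_iff_posSemidef.1 <|
    cfc_nonneg fun _ hx => Real.rpow_nonneg (spectrum_nonneg hσ hx) r

/-- The operator norm is dominated by every Schatten norm. -/
lemma opNorm_le_schattenNorm {α : ℝ} (hα : 0 < α) (Y : Matrix n n ℂ) :
    opNorm Y ≤ schattenNorm α Y := by
  change ‖Y‖ ≤ (power (absOp Y) α).trace.re ^ (1 / α)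
  rw [← norm_absOp]
  have hA := absOp_posSemidef Y
  have hP := power_posSemidef hA α
  have htr : 0 ≤ (power (absOp Y) α).trace.re := (Complex.le_def.1 hP.trace_nonneg).1
  -- Each eigenvalue x of |Y| satisfies x ^ α ≤ Tr |Y|^α; the α-th root is taken below.
  have h := le_trace hP
  rw [CStarAlgebra.norm_le_iff_le_algebraMap _ (Real.rpow_nonneg htr _) hA.nonneg,
    le_algebraMap_iff_spectrum_le hA.1.isSelfAdjoint]
  intro x hx
  have h' := (cfc_le_algebraMap_iff (fun x : ℝ => x ^ α) _ _
    (continuousOn_spectrum _ _) hA.1.isSelfAdjoint).1 h x hx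
  have hx0 := spectrum_nonneg hA hx
  rw [one_div]
  exact (Real.le_rpow_inv_iff_of_pos hx0 htr hα).2 h'

/-- A Schatten norm exceeds the operator norm by a factor of at most `(dim)^(1/α)`. -/
lemma schattenNorm_le {α : ℝ} (hα : 0 < α) (Y : Matrix n n ℂ) {t : ℝ} (h : opNorm Y ≤ t) :
    schattenNorm α Y ≤ (Fintype.card n : ℝ) ^ (1 / α) * t := by
  change ‖Y‖ ≤ t at h
  have ht : 0 ≤ t := (norm_nonneg _).trans h
  rw [← norm_absOp] at h
  have hA := absOp_posSemidef Y
  have hP := power_posSemidef hA α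
  have htr : 0 ≤ (power (absOp Y) α).trace.re := (Complex.le_def.1 hP.trace_nonneg).1
  rw [CStarAlgebra.norm_le_iff_le_algebraMap _ ht hA.nonneg,
    le_algebraMap_iff_spectrum_le hA.1.isSelfAdjoint] at h
  have h' : power (absOp Y) α ≤ algebraMap ℝ _ (t ^ α) :=
    (cfc_le_algebraMap_iff (fun x : ℝ => x ^ α) _ _
      (continuousOn_spectrum _ _) hA.1.isSelfAdjoint).2 fun x hx =>
        Real.rpow_le_rpow (spectrum_nonneg hA hx) (h x hx) hα.le
  have h'' := trace_re_mono h'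
  rw [trace_algebraMap, Complex.ofReal_re] at h''
  calc schattenNorm α Y ≤ ((Fintype.card n : ℝ) * t ^ α) ^ (1 / α) :=
        Real.rpow_le_rpow htr h'' (by positivity)
    _ = _ := by
        rw [Real.mul_rpow (by positivity) (by positivity), ← Real.rpow_mul ht,
          mul_one_div_cancel hα.ne', Real.rpow_one]

/-! ### Supports and conjugation by powers of σ -/

lemma mulVec_eq_zero_of_supp_le {X σ : Matrix n n ℂ} (h : supp X ≤ supp σ) {v : n → ℂ}
    (hv : σ.mulVec v = 0) : X.mulVec v = 0 := by
  have h' := Submodule.orthogonal_le h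
  rw [supp, supp, Submodule.orthogonal_orthogonal, Submodule.orthogonal_orthogonal] at h'
  have hm : WithLp.toLp 2 v ∈ LinearMap.ker (Matrix.toEuclideanLin σ) := by
    rw [LinearMap.mem_ker, Matrix.toLpLin_toLp, Matrix.toLin'_apply, hv]; rfl
  have := h' hm
  rw [LinearMap.mem_ker, Matrix.toLpLin_toLp] at this
  simpa using this

lemma supp_le_of_mulVec {X σ : Matrix n n ℂ}
    (h : ∀ v : n → ℂ, σ.mulVec v = 0 → X.mulVec v = 0) : supp X ≤ supp σ := by
  refine Submodule.orthogonal_le fun v hv => ?_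
  rw [LinearMap.mem_ker, Matrix.toLpLin_apply] at hv ⊢
  rw [h v.ofLp (by simpa using hv)]; rfl

lemma mul_eq_zero_of_supp_le {X σ Z : Matrix n n ℂ} (h : supp X ≤ supp σ)
    (hZ : σ * Z = 0) : X * Z = 0 := by
  refine Matrix.ext_of_mulVec_single fun i => ?_
  rw [← Matrix.mulVec_mulVec, mulVec_eq_zero_of_supp_le h, Matrix.zero_mulVec]
  rw [Matrix.mulVec_mulVec, hZ, Matrix.zero_mulVec]

lemma conj_le {m : Type*} [Fintype m] {A B : Matrix m m ℂ} (h : A ≤ B) {C : Matrix m m ℂ} (hC : IsSelfAdjoint C) :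
    C * A * C ≤ C * B * C := by
  simpa [hC.star_eq] using star_left_conjugate_le_conjugate h C

/-- The projection `σ ^ (-p) * σ ^ p` onto the support of `σ` fixes `X` from both sides. -/
lemma power_conj_cancel {X σ : Matrix n n ℂ} (hX : IsSelfAdjoint X) (hσ : σ.PosSemidef)
    (h : supp X ≤ supp σ) (p : ℝ) :
    power σ (-p) * (power σ p * X * power σ p) * power σ (-p) = X := by
  have hσ' := hσ.1.isSelfAdjoint
  -- The support inclusion passes this annihilation from σ to X.
  have hZ : σ * (1 - power σ p * power σ (-p)) = 0 := by
    rw [mul_sub, mul_one, sub_eq_zero, power, power, cfc_mul_cfc]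
    conv_lhs => rw [← cfc_id ℝ σ hσ']
    conv_rhs => enter [1]; rw [← cfc_id ℝ σ hσ']
    rw [cfc_mul_cfc]
    refine cfc_congr fun x hx => ?_
    rcases (spectrum_nonneg hσ hx).eq_or_lt with rfl | hx0
    · simp
    · simp [← Real.rpow_add hx0]
  have h₁ : X * (power σ p * power σ (-p)) = X := by
    have := mul_eq_zero_of_supp_le h hZ
    rwa [mul_sub, mul_one, sub_eq_zero, eq_comm] at this
  have h₂ : power σ (-p) * power σ p * X = X := by
    have := congrArg star h₁
    rwa [star_mul, star_mul, hX.star_eq, (isSelfAdjoint_power σ p).star_eq,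
      (isSelfAdjoint_power σ (-p)).star_eq] at this
  calc _ = (power σ (-p) * power σ p * X) * (power σ p * power σ (-p)) := by
        simp only [mul_assoc]
    _ = X := by rw [h₂, h₁]

lemma power_mul_algebraMap_mul_power {σ : Matrix n n ℂ} (p t : ℝ) :
    power σ p * algebraMap ℝ _ t * power σ p = t • cfc (fun x : ℝ => x ^ p * x ^ p) σ := by
  rw [Algebra.algebraMap_eq_smul_one, mul_smul_comm, mul_one, smul_mul_assoc, power, cfc_mul_cfc]

lemma isSelfAdjoint_power_conj {X : Matrix n n ℂ} (hX : IsSelfAdjoint X) (σ : Matrix n n ℂ)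
    (p : ℝ) : IsSelfAdjoint (power σ p * X * power σ p) := by
  simpa [(isSelfAdjoint_power σ p).star_eq] using hX.conjugate (power σ p)

lemma le_of_opNorm_le {X σ : Matrix n n ℂ} (hX : IsSelfAdjoint X) (hσ : σ.PosSemidef)
    (h : supp X ≤ supp σ) {p t : ℝ}
    (ht : opNorm (power σ p * X * power σ p) ≤ t) :
    -(t • cfc (fun x : ℝ => x ^ (-p) * x ^ (-p)) σ) ≤ X ∧
      X ≤ t • cfc (fun x : ℝ => x ^ (-p) * x ^ (-p)) σ := by
  obtain ⟨h₁, h₂⟩ := le_of_norm_le (isSelfAdjoint_power_conj hX σ p) ht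
  have h₁' := conj_le h₁ (isSelfAdjoint_power σ (-p))
  have h₂' := conj_le h₂ (isSelfAdjoint_power σ (-p))
  rw [power_conj_cancel hX hσ h p] at h₁' h₂'
  rw [mul_neg, neg_mul] at h₁'
  rw [power_mul_algebraMap_mul_power] at h₁' h₂'
  exact ⟨h₁', h₂'⟩

/-- If σv = 0, both inequalities force ⟨v, Xv⟩ = 0. Then the positive semidefinite operator X + tσ
has vanishing quadratic form at v, so it kills v, and Xv = 0. -/
lemma supp_le_of_le {X σ : Matrix n n ℂ} {t : ℝ}
    (h₁ : -(t • σ) ≤ X) (h₂ : X ≤ t • σ) : supp X ≤ supp σ := by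
  refine supp_le_of_mulVec fun v hv => ?_
  have e₁ := (Matrix.le_iff.1 h₁)
  have e₂ := (Matrix.le_iff.1 h₂)
  have a₁ := e₁.dotProduct_mulVec_nonneg v
  have a₂ := e₂.dotProduct_mulVec_nonneg v
  have hs : (t • σ).mulVec v = 0 := by rw [Matrix.smul_mulVec, hv, smul_zero]
  rw [sub_neg_eq_add, Matrix.add_mulVec, hs, add_zero] at a₁
  rw [Matrix.sub_mulVec, hs, zero_sub, dotProduct_neg, neg_nonneg] at a₂
  have := (e₁.dotProduct_mulVec_zero_iff v).1 (by
    rw [sub_neg_eq_add, Matrix.add_mulVec, hs, add_zero]; exact le_antisymm a₂ a₁)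
  rwa [sub_neg_eq_add, Matrix.add_mulVec, hs, add_zero] at this

/-- Conjugating tσ by σ^p gives t σ^(2p+1) on the support, which is at most t because σ ≤ 1 and 2p +
1 ≥ 0. -/
lemma opNorm_power_conj_le {X σ : Matrix n n ℂ} (hX : IsSelfAdjoint X) (hσ : σ.PosSemidef)
    (hσ₁ : σ ≤ 1) {t : ℝ} (ht : 0 ≤ t) (h₁ : -(t • σ) ≤ X) (h₂ : X ≤ t • σ)
    {p : ℝ} (hp : -1 / 2 ≤ p) : opNorm (power σ p * X * power σ p) ≤ t := by
  have hσ' := hσ.1.isSelfAdjoint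
  have key : power σ p * (t • σ) * power σ p ≤ algebraMap ℝ _ t := by
    have e : power σ p * σ * power σ p = cfc (fun x : ℝ => x ^ p * x * x ^ p) σ := by
      conv_lhs => enter [1, 2]; rw [← cfc_id ℝ σ hσ']
      rw [power, cfc_mul_cfc, cfc_mul_cfc]; rfl
    have : power σ p * σ * power σ p ≤ 1 := by
      rw [e]
      refine cfc_le_one _ _ fun x hx => ?_
      have hx1 : x ≤ 1 := (le_algebraMap_iff_spectrum_le hσ').1
        (by simpa using hσ₁ : σ ≤ algebraMap ℝ _ 1) x hx
      rcases (spectrum_nonneg hσ hx).eq_or_lt with rfl | hx0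
      · simp
      · calc x ^ p * x * x ^ p = x ^ (p + 1 + p) := by
              rw [Real.rpow_add hx0, Real.rpow_add hx0, Real.rpow_one]
          _ ≤ 1 := Real.rpow_le_one hx0.le hx1 (by linarith)
    rw [mul_smul_comm, smul_mul_assoc, Algebra.algebraMap_eq_smul_one]
    exact smul_le_smul_of_nonneg_left this ht
  have k₁ := conj_le h₁ (isSelfAdjoint_power σ p)
  have k₂ := conj_le h₂ (isSelfAdjoint_power σ p)
  rw [mul_neg, neg_mul] at k₁
  exact norm_le_of_neg_le_of_le (isSelfAdjoint_power_conj hX σ p) ht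
    ((neg_le_neg key).trans k₁) (k₂.trans key)

end Operators

/-! ### Comparison of κ with the negativities -/

section Bipartite

variable {a b : Type*} [Fintype a] [DecidableEq a] [Fintype b] [DecidableEq b]

/-- The quantity whose logarithm is `Ekappa ρ`. -/
noncomputable def kappa (ρ : Matrix (a × b) (a × b) ℂ) : ℝ≥0∞ :=
  ⨅ S ∈ kappaFeasible ρ, ENNReal.ofReal S.trace.re

/-- The witness is S = t T_B(τ). The trace of τ is left free so that the perturbed state σ + 1/α can
be used as τ. -/
lemma kappa_le {ρ τ : Matrix (a × b) (a × b) ℂ} (hτ : 0 ≤ partialTranspose τ) {t : ℝ}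
    (ht : 0 ≤ t) (h₁ : -(t • τ) ≤ partialTranspose ρ) (h₂ : partialTranspose ρ ≤ t • τ) :
    kappa ρ ≤ ENNReal.ofReal (t * τ.trace.re) := by
  have e : partialTranspose (t • partialTranspose τ) = t • τ := rfl
  have e' : (partialTranspose τ).trace = τ.trace := rfl
  have := iInf₂_le (f := fun S (_ : S ∈ kappaFeasible ρ) => ENNReal.ofReal S.trace.re)
    (t • partialTranspose τ) ⟨by rwa [e], by rwa [e], smul_nonneg ht hτ⟩
  rwa [Matrix.trace_smul, e', Complex.smul_re, smul_eq_mul] at this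

lemma isSelfAdjoint_partialTranspose {a b : Type*} {ρ : Matrix (a × b) (a × b) ℂ}
    (h : ρ.IsHermitian) :
    IsSelfAdjoint (partialTranspose ρ) := by
  ext p q
  exact congrFun (congrFun h (p.1, q.2)) (q.1, p.2)

lemma partialTranspose_one {a b : Type*} [DecidableEq a] [DecidableEq b] :
    partialTranspose (1 : Matrix (a × b) (a × b) ℂ) = 1 := by
  ext ⟨i, j⟩ ⟨k, l⟩
  simp only [partialTranspose, Matrix.of_apply, Matrix.one_apply, Prod.mk.injEq]
  simp only [eq_comm]

/-- The quantity whose logarithm is `Dmax X σ`. -/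
noncomputable def muMax {n : Type*} [Fintype n] [DecidableEq n] (X σ : Matrix n n ℂ) : ℝ≥0∞ :=
  open Classical in
  if supp X ≤ supp σ then
    ENNReal.ofReal (opNorm (power σ (-1 / 2) * X * power σ (-1 / 2)))
  else ⊤

lemma kappa_le_muMax {ρ σ : Matrix (a × b) (a × b) ℂ} (hρ : IsState ρ) (hσ : σ ∈ PPT a b) :
    kappa ρ ≤ muMax (partialTranspose ρ) σ := by
  rw [muMax]
  split_ifs with h
  swap
  · exact le_top
  obtain ⟨h₁, h₂⟩ := le_of_opNorm_le (isSelfAdjoint_partialTranspose hρ.1.1) hσ.1 h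
    (p := -1 / 2) le_rfl
  have e : cfc (fun x : ℝ => x ^ (-(-1 / 2 : ℝ)) * x ^ (-(-1 / 2 : ℝ))) σ = σ := by
    conv_rhs => rw [← cfc_id ℝ σ hσ.1.1.isSelfAdjoint]
    refine cfc_congr fun x hx => ?_
    have hx0 := spectrum_nonneg hσ.1 hx
    simp only [id]
    rw [← Real.rpow_add_of_nonneg hx0 (by norm_num) (by norm_num)]
    norm_num
  rw [e] at h₁ h₂
  have := kappa_le hσ.2.1.nonneg (norm_nonneg _) h₁ h₂
  rwa [hσ.2.2, Complex.one_re, mul_one] at this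

/-- Concavity of the power function: `σ ^ (1 - 1 / α) ≤ σ + 1 / α`. -/
lemma cfc_rpow_le {n : Type*} [Fintype n] [DecidableEq n] {σ : Matrix n n ℂ}
    (hσ : σ.PosSemidef) {α : ℝ} (hα : 1 < α) :
    cfc (fun x : ℝ => x ^ (-((1 - α) / (2 * α))) * x ^ (-((1 - α) / (2 * α)))) σ ≤
      σ + α⁻¹ • (1 : Matrix n n ℂ) := by
  have hα0 : 0 < α := by linarith
  have hp : 0 ≤ -((1 - α) / (2 * α)) := by
    rw [← neg_div]; exact div_nonneg (by linarith) (by linarith)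
  have e : σ + α⁻¹ • (1 : Matrix n n ℂ) = cfc (fun x : ℝ => x + α⁻¹) σ := by
    rw [cfc_add_const _ _ _ (continuousOn_spectrum _ _) hσ.1.isSelfAdjoint,
      cfc_id' ℝ σ hσ.1.isSelfAdjoint, Algebra.algebraMap_eq_smul_one]
  rw [e]
  refine cfc_mono (fun x hx => ?_) (continuousOn_spectrum _ _) (continuousOn_spectrum _ _)
  have hx0 := spectrum_nonneg hσ hx
  rw [← Real.rpow_add_of_nonneg hx0 hp hp]
  have e' : -((1 - α) / (2 * α)) + -((1 - α) / (2 * α)) = 1 - α⁻¹ := by field_simp; ring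
  have hs : α⁻¹ ≤ 1 := inv_le_one_of_one_le₀ hα.le
  have hs0 : 0 ≤ α⁻¹ := by positivity
  -- Weighted AM-GM for x and 1: x^(1-s) ≤ (1-s) x + s ≤ x + s with s = 1/α.
  have := Real.geom_mean_le_arith_mean2_weighted (sub_nonneg.2 hs) hs0 hx0 zero_le_one
    (sub_add_cancel 1 α⁻¹)
  rw [Real.one_rpow, mul_one, mul_one] at this
  rw [e']
  nlinarith

/-- The operator σ^(1-1/α) need not have a positive partial transpose, but its upper bound σ + 1/α
does, since T_B fixes the identity. -/
lemma kappa_le_mu {ρ σ : Matrix (a × b) (a × b) ℂ} (hρ : IsState ρ) (hσ : σ ∈ PPT a b)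
    {α : ℝ} (hα : 1 < α) :
    kappa ρ ≤
      ENNReal.ofReal (1 + Fintype.card (a × b) * α⁻¹) * mu α (partialTranspose ρ) σ := by
  have hα0 : 0 < α := by linarith
  have hc : 0 < 1 + Fintype.card (a × b) * α⁻¹ := by positivity
  rw [mu]
  split_ifs with h
  swap
  · rw [ENNReal.mul_top (by simpa using hc)]; exact le_top
  have hle := opNorm_le_schattenNorm hα0 (power σ ((1 - α) / (2 * α)) * partialTranspose ρ *
    power σ ((1 - α) / (2 * α)))
  have ht := (norm_nonneg _).trans hle
  obtain ⟨h₁, h₂⟩ := le_of_opNorm_le (isSelfAdjoint_partialTranspose hρ.1.1) hσ.1 h hle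
  have hm := smul_le_smul_of_nonneg_left (cfc_rpow_le hσ.1 hα) ht
  have hT : 0 ≤ partialTranspose (σ + α⁻¹ • (1 : Matrix (a × b) (a × b) ℂ)) := by
    have : partialTranspose (σ + α⁻¹ • (1 : Matrix (a × b) (a × b) ℂ)) =
        partialTranspose σ + α⁻¹ • partialTranspose 1 := rfl
    rw [this, partialTranspose_one]
    exact add_nonneg hσ.2.1.nonneg (smul_nonneg (by positivity) zero_le_one)
  have := kappa_le hT ht ((neg_le_neg hm).trans h₁) (h₂.trans hm)
  rw [← ENNReal.ofReal_mul hc.le, mul_comm]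
  convert this using 3
  rw [Matrix.trace_add, hσ.2.2, Matrix.trace_smul, Matrix.trace_one]
  simp [mul_comm]

/-- The partial transpose of a feasible operator, normalized, is a PPT state for which both
quantities are controlled by the trace of the operator. -/
lemma exists_mem_PPT {ρ S : Matrix (a × b) (a × b) ℂ} (hρ : IsState ρ)
    (hS : S ∈ kappaFeasible ρ) :
    ∃ σ ∈ PPT a b, muMax (partialTranspose ρ) σ ≤ ENNReal.ofReal S.trace.re ∧
      ∀ α : ℝ, 1 < α → mu α (partialTranspose ρ) σ ≤
        ENNReal.ofReal ((Fintype.card (a × b) : ℝ) ^ (1 / α)) * ENNReal.ofReal S.trace.re := by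
  obtain ⟨h₁, h₂, h₀⟩ := hS
  have hX := isSelfAdjoint_partialTranspose hρ.1.1
  have hTS : 0 ≤ partialTranspose S := by
    have h : 0 ≤ (2 : ℝ) • partialTranspose S := by
      rw [two_smul]
      have := h₁.trans h₂
      rwa [neg_le_iff_add_nonneg] at this
    simpa using smul_nonneg (by norm_num : (0 : ℝ) ≤ 2⁻¹) h
  -- T_B preserves the trace, so X ≤ T_B(S) gives 1 = Tr ρ ≤ Tr S; in particular S can be
  -- normalized.
  have ht : 1 ≤ S.trace.re := by
    have := trace_re_mono h₂
    have e₁ : (partialTranspose ρ).trace = ρ.trace := rfl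
    have e₂ : (partialTranspose S).trace = S.trace := rfl
    rwa [e₁, e₂, hρ.2, Complex.one_re] at this
  set t := S.trace.re with ht_def
  have ht0 : 0 < t := by linarith
  have htS : S.trace = (t : ℂ) := by
    have := (Complex.le_def.1 (Matrix.nonneg_iff_posSemidef.1 h₀).trace_nonneg).2
    exact Complex.ext rfl this.symm
  set σ := t⁻¹ • partialTranspose S with hσ_def
  have hσ : σ ∈ PPT a b := by
    refine ⟨Matrix.nonneg_iff_posSemidef.1 (smul_nonneg (by positivity) hTS),
      Matrix.nonneg_iff_posSemidef.1 (smul_nonneg (by positivity : 0 ≤ t⁻¹) h₀), ?_⟩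
    have e₂ : (partialTranspose S).trace = S.trace := rfl
    rw [hσ_def, Matrix.trace_smul, e₂, htS, Complex.real_smul, ← Complex.ofReal_mul,
      inv_mul_cancel₀ ht0.ne', Complex.ofReal_one]
  have hσt : partialTranspose S = t • σ := by rw [hσ_def, smul_inv_smul₀ ht0.ne']
  rw [hσt] at h₁ h₂
  have hσ₁ : σ ≤ 1 := by simpa [hσ.2.2] using le_trace hσ.1
  have hsupp := supp_le_of_le h₁ h₂
  refine ⟨σ, hσ, ?_, fun α hα => ?_⟩
  · rw [muMax, if_pos hsupp]
    exact ENNReal.ofReal_le_ofReal (opNorm_power_conj_le hX hσ.1 hσ₁ ht0.le h₁ h₂ le_rfl)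
  · have hα0 : 0 < α := by linarith
    rw [mu, if_pos hsupp, ← ENNReal.ofReal_mul (by positivity)]
    refine ENNReal.ofReal_le_ofReal (schattenNorm_le hα0 _
      (opNorm_power_conj_le hX hσ.1 hσ₁ ht0.le h₁ h₂ ?_))
    -- The exponent (1-α)/(2α) = -1/2 + 1/(2α) is at least -1/2.
    rw [div_le_div_iff₀ (by norm_num) (by linarith)]
    linarith

lemma kappa_eq_iInf_muMax {ρ : Matrix (a × b) (a × b) ℂ} (hρ : IsState ρ) :
    kappa ρ =
      ⨅ σ ∈ PPT a b, muMax (partialTranspose ρ) σ := by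
  refine le_antisymm (le_iInf₂ fun σ hσ => kappa_le_muMax hρ hσ) (le_iInf₂ fun S hS => ?_)
  obtain ⟨σ, hσ, h, -⟩ := exists_mem_PPT hρ hS
  exact (iInf₂_le σ hσ).trans h

lemma Ekappa_eq_maxLogNegativity {ρ : Matrix (a × b) (a × b) ℂ} (hρ : IsState ρ) :
    Ekappa ρ = maxLogNegativity ρ := by
  change log2 (kappa ρ) = _
  rw [kappa_eq_iInf_muMax hρ, log2_biInf]
  rfl

lemma tendsto_iInf_mu {ρ : Matrix (a × b) (a × b) ℂ} (hρ : IsState ρ) :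
    Tendsto (fun α : ℝ => ⨅ σ ∈ PPT a b, mu α (partialTranspose ρ) σ) atTop
      (𝓝 (kappa ρ)) := by
  set d : ℝ := (Fintype.card (a × b) : ℝ) with hd
  -- A state has trace 1, which excludes dimension 0; d > 0 is needed for d^(1/α) → 1.
  have hd0 : 0 < d := by
    have : Nonempty (a × b) := by
      by_contra h
      rw [not_nonempty_iff] at h
      have := hρ.2
      rw [Matrix.trace_eq_zero_of_isEmpty] at this
      exact zero_ne_one this
    exact Nat.cast_pos.2 Fintype.card_pos
  have hlow : Tendsto (fun α : ℝ => kappa ρ / ENNReal.ofReal (1 + d * α⁻¹)) atTop (𝓝 (kappa ρ)) := by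
    have h : Tendsto (fun α : ℝ => ENNReal.ofReal (1 + d * α⁻¹)) atTop (𝓝 1) := by
      have : Tendsto (fun α : ℝ => 1 + d * α⁻¹) atTop (𝓝 (1 + d * 0)) :=
        (tendsto_inv_atTop_zero.const_mul d).const_add 1
      simpa using ENNReal.tendsto_ofReal this
    simpa using ENNReal.Tendsto.const_div h (Or.inl ENNReal.one_ne_top)
  have hupp : Tendsto (fun α : ℝ => ENNReal.ofReal (d ^ (1 / α)) * kappa ρ) atTop (𝓝 (kappa ρ)) := by
    have h : Tendsto (fun α : ℝ => ENNReal.ofReal (d ^ (1 / α))) atTop (𝓝 1) := by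
      have : Tendsto (fun α : ℝ => d ^ (1 / α)) atTop (𝓝 (d ^ (0 : ℝ))) := by
        simpa [one_div, Function.comp_def] using (Real.continuousAt_const_rpow hd0.ne').tendsto.comp
          (tendsto_inv_atTop_zero (𝕜 := ℝ))
      simpa using ENNReal.tendsto_ofReal this
    simpa using ENNReal.Tendsto.mul_const h (Or.inl one_ne_zero)
  refine tendsto_of_tendsto_of_tendsto_of_le_of_le' hlow hupp ?_ ?_
  · filter_upwards [eventually_gt_atTop 1] with α hα
    refine le_iInf₂ fun σ hσ => ENNReal.div_le_of_le_mul' (kappa_le_mu hρ hσ hα)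
  · filter_upwards [eventually_gt_atTop 1] with α hα
    have hc : ENNReal.ofReal (d ^ (1 / α)) ≠ 0 := by
      simpa using Real.rpow_pos_of_pos hd0 _
    rw [kappa, ENNReal.mul_iInf_of_ne hc ENNReal.ofReal_ne_top]
    refine le_iInf fun S => ?_
    rw [ENNReal.mul_iInf_of_ne hc ENNReal.ofReal_ne_top]
    refine le_iInf fun hS => ?_
    obtain ⟨σ, hσ, -, h⟩ := exists_mem_PPT hρ hS
    exact (iInf₂_le σ hσ).trans (h α hα)

end Bipartite

end LogNeg

theorem mainTheorem3 {a b : Type*} [Fintype a] [DecidableEq a] [Fintype b] [DecidableEq b]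
    (ρ : Matrix (a × b) (a × b) ℂ) (hρ : LogNeg.IsState ρ) :
    LogNeg.Ekappa ρ = LogNeg.maxLogNegativity ρ ∧
      Tendsto (fun α : ℝ => LogNeg.logNegativity α ρ) atTop (𝓝 (LogNeg.maxLogNegativity ρ)) := by
  refine ⟨LogNeg.Ekappa_eq_maxLogNegativity hρ, ?_⟩
  rw [← LogNeg.Ekappa_eq_maxLogNegativity hρ]
  have h := (LogNeg.continuous_log2.tendsto _).comp (LogNeg.tendsto_iInf_mu hρ)
  refine h.congr fun α => ?_
  exact LogNeg.log2_biInf _ _
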